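/- Let $\mathcal{A}$ be a bicomplete abelian category with enough projective and enough injective objects; let $\mathcal{P}$ and $\mathcal{I}$ denote the classes of projective and injective objects. For a class $\mathcal{C}$ of objects put ${}^{\perp}\mathcal{C}=\{M\mid \mathrm{Ext}^1_{\mathcal A}(M,C)=0\ \forall C\in\mathcal{C}\}$ and $\mathcal{C}^{\perp}=\{M\mid \mathrm{Ext}^1_{\mathcal A}(C,M)=0\ \forall C\in\mathcal{C}\}$. Let $(\mathcal{X},\mathcal{Z},\mathcal{Y})$ be a complete and hereditary cotorsion triple in $\mathcal{A}$: for each of the pairs $(\mathcal{U},\mathcal{V})=(\mathcal{X},\mathcal{Z})$ and $(\mathcal{Z},\mathcal{Y})$ one has $\mathcal{U}={}^{\perp}\mathcal{V}$ and $\mathcal{V}=\mathcal{U}^{\perp}$; every object $M$ admits short exact sequences $0\to V\to U\to M\to 0$ and $0\to M\to V'\to U'\to 0$ with $U,U'\in\mathcal{U}$, $V,V'\in\mathcal{V}$; and $\mathcal{U}$ is resolving, i.e. it contains all projective objects and for every short exact sequence $0\to U'\to U\to U''\to 0$ with $U''\in\mathcal{U}$ one has $U\in\mathcal{U}$ if and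 only if $U'\in\mathcal{U}$. The stable category $\mathcal{X}/\mathcal{P}$ has the objects of $\mathcal{X}$, and its morphisms are the morphisms of $\mathcal{A}$ between them modulo those factoring through a projective object; $\mathcal{Y}/\mathcal{I}$ is defined in the same way with injective objects. A special right $\mathcal{X}$-approximation of $M$ is an epimorphism $X_M\to M$ with $X_M\in\mathcal{X}$ and kernel in $\mathcal{X}^{\perp}$, through which every morphism from an object of $\mathcal{X}$ to $M$ factors; a special left $\mathcal{Y}$-approximation of $M$ is a monomorphism $M\to Y^M$ with $Y^M\in\mathcal{Y}$ and cokernel in ${}^{\perp}\mathcal{Y}$, through which every morphism from $M$ to an object of $\mathcal{Y}$ factors. Let $\mathrm{Ho}(\mathcal{A})$ be the homotopy category of the projective model structure, that is, the localization of $\mathcal{A}$ at the morphisms of the form $p\circ i$ with $i$ a monomorphism with cokernel in $\mathcal{X}\cap\mathcal{Z}$ and $p$ an epimorphism with kernel in $\mathcal{Z}$. Then the inclusion $\mathcal{X}\subseteq\mathcal{A}$ induces an equivalence $\mathcal{X}/\mathcal{P}\simeq\mathrm{Ho}(\mathcal{A})$. Call objects $M,N$ of $\mathcal{A}$ equivalent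 in $\mathcal{X}/\mathcal{P}$ if their images under $\mathcal{A}\to\mathrm{Ho}(\mathcal{A})\simeq\mathcal{X}/\mathcal{P}$ are isomorphic. For all objects $M,N$ of $\mathcal{A}$ the following are equivalent: 1. $M$ and $N$ are equivalent in $\mathcal{X}/\mathcal{P}$; 2. there are special right $\mathcal{X}$-approximations $X_M\to M$, $X_N\to N$ and projective objects $P,F$ with $X_M\oplus P\cong X_N\oplus F$; 3. for all special right $\mathcal{X}$-approximations $X_M\to M$, $X_N\to N$ there are projective objects $P,F$ with $X_M\oplus P\cong X_N\oplus F$. Dually, let $\mathrm{Ho}(\mathcal{A})$ now be the homotopy category of the injective model structure, that is, the localization of $\mathcal{A}$ at the morphisms $p\circ i$ with $i$ a monomorphism with cokernel in $\mathcal{Z}$ and $p$ an epimorphism with kernel in $\mathcal{Z}\cap\mathcal{Y}$. Then the inclusion $\mathcal{Y}\subseteq\mathcal{A}$ induces an equivalence $\mathcal{Y}/\mathcal{I}\simeq\mathrm{Ho}(\mathcal{A})$, and, with equivalence in $\mathcal{Y}/\mathcal{I}$ defined accordingly, for all objects $M,N$ of $\mathcal{A}$ the following are equivalent: 1. $M$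 and $N$ are equivalent in $\mathcal{Y}/\mathcal{I}$; 2. there are special left $\mathcal{Y}$-approximations $M\to Y^M$, $N\to Y^N$ and injective objects $I,J$ with $Y^M\oplus I\cong Y^N\oplus J$; 3. for all special left $\mathcal{Y}$-approximations $M\to Y^M$, $N\to Y^N$ there are injective objects $I,J$ with $Y^M\oplus I\cong Y^N\oplus J$. -/

import Mathlib

open CategoryTheory CategoryTheory.Limits

universe w v u v' u'

namespace Cotorsion

section Classes

variable {A : Type u} [Category.{v} A] [Abelian A]

/-- Every object `M` has short exact sequences `0 ⟶ K ⟶ E ⟶ M ⟶ 0` and `0 ⟶ M ⟶ E' ⟶ C ⟶ 0`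
with `E, C` in `X` and `K, E'` in `Y`. -/
structure IsCompletePair (X Y : ObjectProperty A) : Prop where
  exists_left : ∀ M : A, ∃ (K E : A) (i : K ⟶ E) (p : E ⟶ M) (h : i ≫ p = 0),
    (ShortComplex.mk i p h).ShortExact ∧ Y K ∧ X E
  exists_right : ∀ M : A, ∃ (E C : A) (i : M ⟶ E) (p : E ⟶ C) (h : i ≫ p = 0),
    (ShortComplex.mk i p h).ShortExact ∧ Y E ∧ X C

/-- A class is resolving if it contains the projectives and, in every short exact sequence
whose third term belongs to the class, the middle term does iff the first term does. -/
structure IsResolving (X : ObjectProperty A) : Prop where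
  projective_mem : ∀ P : A, Projective P → X P
  mem_iff : ∀ S : ShortComplex A, S.ShortExact → X S.X₃ → (X S.X₂ ↔ X S.X₁)

/-- `f : X₀ ⟶ M` is a right `X`-approximation of `M`. -/
structure IsRightApproximation (X : ObjectProperty A) {X₀ M : A} (f : X₀ ⟶ M) : Prop where
  mem : X X₀
  factors : ∀ (X' : A), X X' → ∀ g : X' ⟶ M, ∃ h : X' ⟶ X₀, h ≫ f = g

/-- `f : M ⟶ Y₀` is a left `Y`-approximation of `M`. -/
structure IsLeftApproximation (Y : ObjectProperty A) {M Y₀ : A} (f : M ⟶ Y₀) : Prop where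
  mem : Y Y₀
  factors : ∀ (Y' : A), Y Y' → ∀ g : M ⟶ Y', ∃ h : Y₀ ⟶ Y', f ≫ h = g

end Classes

section Pairs

variable {A : Type u} [Category.{v} A] [Abelian A] [HasExt.{w} A]

/-- `leftPerp P` consists of the `X` with `Ext¹(X, Y) = 0` for every `Y` in `P`. -/
def leftPerp (P : ObjectProperty A) : ObjectProperty A :=
  fun X => ∀ Y : A, P Y → Subsingleton (Abelian.Ext.{w} X Y 1)

/-- `rightPerp P` consists of the `Y` with `Ext¹(X, Y) = 0` for every `X` in `P`. -/
def rightPerp (P : ObjectProperty A) : ObjectProperty A :=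
  fun Y => ∀ X : A, P X → Subsingleton (Abelian.Ext.{w} X Y 1)

/-- `(X, Y)` is a cotorsion pair: each class is the `Ext¹`-orthogonal of the other. -/
structure IsCotorsionPair (X Y : ObjectProperty A) : Prop where
  left_eq : X = leftPerp.{w} Y
  right_eq : Y = rightPerp.{w} X

/-- A complete and hereditary cotorsion triple `(X, Z, Y)`: both `(X, Z)` and `(Z, Y)` are
complete hereditary cotorsion pairs (hereditary means that the left class is resolving). -/
structure IsCompleteHereditaryTriple (X Z Y : ObjectProperty A) : Prop where
  pair_left : IsCotorsionPair.{w} X Z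
  pair_right : IsCotorsionPair.{w} Z Y
  complete_left : IsCompletePair X Z
  complete_right : IsCompletePair Z Y
  hereditary_left : IsResolving X
  hereditary_right : IsResolving Z

/-- A special right `X`-approximation: an epic one with kernel right orthogonal to `X`. -/
structure IsSpecialRightApproximation (X : ObjectProperty A) {X₀ M : A} (f : X₀ ⟶ M) : Prop
    extends IsRightApproximation X f where
  epi : Epi f
  kernel_mem : rightPerp.{w} X (kernel f)

/-- A special left `Y`-approximation: a monic one with cokernel left orthogonal to `Y`. -/
structure IsSpecialLeftApproximation (Y : ObjectProperty A) {M Y₀ : A} (f : M ⟶ Y₀) : Prop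
    extends IsLeftApproximation Y f where
  mono : Mono f
  cokernel_mem : leftPerp.{w} Y (cokernel f)

end Pairs

section Homotopy

variable {A : Type u} [Category.{v} A] [Abelian A]

/-- The weak equivalences of an abelian model structure with classes `C`, `W`, `F` of cofibrant,
trivial and fibrant objects: the composites of a trivial cofibration (a monomorphism whose
cokernel is cofibrant and trivial) followed by a trivial fibration (an epimorphism whose
kernel is fibrant and trivial). -/
def weakEquivalences (C W F : ObjectProperty A) : MorphismProperty A :=
  fun M N f => ∃ (L : A) (i : M ⟶ L) (p : L ⟶ N), i ≫ p = f ∧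
    Mono i ∧ C (cokernel i) ∧ W (cokernel i) ∧
    Epi p ∧ F (kernel p) ∧ W (kernel p)

/-- Weak equivalences of the projective model structure attached to `(X, Z, Y)`: the cofibrant
objects are those of `X`, the trivial ones those of `Z`, and all objects are fibrant. -/
def projectiveWeakEquivalences (X Z : ObjectProperty A) : MorphismProperty A :=
  weakEquivalences X Z ⊤

/-- Weak equivalences of the injective model structure attached to `(X, Z, Y)`: all objects are
cofibrant, the trivial objects are those of `Z`, and the fibrant ones those of `Y`. -/
def injectiveWeakEquivalences (Z Y : ObjectProperty A) : MorphismProperty A :=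
  weakEquivalences ⊤ Z Y

end Homotopy

section Stable

/-- Stable equivalence of morphisms modulo `C`: the difference factors through an object
of `C`. -/
def stableRel {D : Type u'} [Category.{v'} D] [Preadditive D] (C : ObjectProperty D) : HomRel D :=
  fun M N f g => ∃ (c : D) (_ : C c) (a : M ⟶ c) (b : c ⟶ N), f - g = a ≫ b

/-- The stable category `D / C`: the objects of `D`, with stable equivalence classes of
morphisms. -/
abbrev StableCategory (D : Type u') [Category.{v'} D] [Preadditive D] (C : ObjectProperty D) :=
  CategoryTheory.Quotient (stableRel C)

variable {A : Type u} [Category.{v} A] [Abelian A]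

/-- The stable category `X / P` of a full subcategory `X` modulo the projective objects
of `A`. -/
abbrev ModProjectives (X : ObjectProperty A) :=
  StableCategory X.FullSubcategory ((isProjective A).inverseImage X.ι)

/-- The stable category `Y / I` of a full subcategory `Y` modulo the injective objects
of `A`. -/
abbrev ModInjectives (Y : ObjectProperty A) :=
  StableCategory Y.FullSubcategory ((isInjective A).inverseImage Y.ι)

end Stable

end Cotorsion

/-! The three classes meet in the expected way: `X ∩ Z` consists of projectives and `Z ∩ Y` of
injectives. More precisely, every morphism from `X` to `Z` factors through a projective, because a
projective cover of the target by `EnoughProjectives` has its kernel in `Z` and `Ext¹(X, Z) = 0`;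
dually every morphism from `Z` to `Y` factors through an injective (`factors_through_projective`,
`factors_through_injective`).

Hence a projective weak equivalence is a split monomorphism with projective cokernel followed by an
epimorphism with kernel in `Z`, and both induce bijections on stable morphisms out of objects of `X`
(`IsStablyColocal`). A special right approximation is itself such a weak equivalence, so choosing
one for each `M` gives a functor from `A` to `X / P` that inverts the weak equivalences. Its
factorization through the localization is inverse to the functor induced by the inclusion
(`exists_equivalence_of_colocal`); neither a calculus of fractions nor the axioms of a model
structure are needed.

Thus `M` and `N` are equivalent iff their approximations, whichever are chosen, are isomorphic in
the stable category. An elementary splitting argument (`IsStableIdeal.exists_biprod_iso`) turns such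
an isomorphism into an isomorphism in `A` after adding projectives. The injective side is dual. -/

namespace Cotorsion

/-! ### Morphisms modulo a class of objects. -/

section Stable

variable {A : Type u} [Category.{v} A] [Preadditive A] {C : ObjectProperty A}

lemma stableRel.symm {M N : A} {f g : M ⟶ N} (h : stableRel C f g) : stableRel C g f := by
  obtain ⟨c, hc, a, b, e⟩ := h
  exact ⟨c, hc, -a, b, by rw [Preadditive.neg_comp, ← e, neg_sub]⟩

lemma stableRel.trans [HasBinaryBiproducts A] (hC : ∀ c d, C c → C d → C (c ⊞ d))
    {M N : A} {f g h : M ⟶ N} (h₁ : stableRel C f g) (h₂ : stableRel C g h) :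
    stableRel C f h := by
  obtain ⟨c, hc, a, b, e⟩ := h₁
  obtain ⟨c', hc', a', b', e'⟩ := h₂
  exact ⟨c ⊞ c', hC _ _ hc hc', biprod.lift a a', biprod.desc b b', by
    rw [biprod.lift_desc, ← e, ← e', sub_add_sub_cancel]⟩

lemma stableRel.precomp {L M N : A} (k : L ⟶ M) {f g : M ⟶ N} (h : stableRel C f g) :
    stableRel C (k ≫ f) (k ≫ g) := by
  obtain ⟨c, hc, a, b, e⟩ := h
  exact ⟨c, hc, k ≫ a, b, by rw [← Preadditive.comp_sub, e, Category.assoc]⟩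

lemma stableRel.postcomp {L M N : A} (k : N ⟶ L) {f g : M ⟶ N} (h : stableRel C f g) :
    stableRel C (f ≫ k) (g ≫ k) := by
  obtain ⟨c, hc, a, b, e⟩ := h
  exact ⟨c, hc, a, b ≫ k, by rw [← Preadditive.sub_comp, e, Category.assoc]⟩

lemma stableRel_refl (hC : ∃ c, C c) {M N : A} (f : M ⟶ N) : stableRel C f f := by
  obtain ⟨c, hc⟩ := hC
  exact ⟨c, hc, 0, 0, by simp⟩

/-- Since `C ≤ X`, the object factored through lies in the subcategory anyway. Stable equivalence
can therefore be computed in `A`, where biproducts are at hand. -/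
lemma stableRel_fullSubcategory_iff {X : ObjectProperty A} (hCX : C ≤ X)
    {M N : X.FullSubcategory} (f g : M ⟶ N) :
    stableRel (C.inverseImage X.ι) f g ↔ stableRel C f.hom g.hom := by
  constructor
  · rintro ⟨c, hc, a, b, e⟩
    exact ⟨c.obj, hc, a.hom, b.hom, congrArg (·.hom) e⟩
  · rintro ⟨c, hc, a, b, e⟩
    refine ⟨⟨c, hCX _ hc⟩, hc, ObjectProperty.homMk a, ObjectProperty.homMk b, ?_⟩
    ext
    exact e

/-- A class of objects that is inhabited, closed under binary biproducts and retracts. -/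
structure IsStableIdeal [HasBinaryBiproducts A] (C : ObjectProperty A) : Prop where
  nonempty : ∃ c, C c
  biprod : ∀ c d, C c → C d → C (c ⊞ d)
  retract : ∀ {c d : A} (i : d ⟶ c) (r : c ⟶ d), i ≫ r = 𝟙 d → C c → C d

lemma IsStableIdeal.congruence [HasBinaryBiproducts A] (hC : IsStableIdeal C)
    {X : ObjectProperty A} (hCX : C ≤ X) :
    Congruence (stableRel (C.inverseImage X.ι)) where
  comp_left f _ _ h := h.precomp f
  comp_right g h := h.postcomp g
  equivalence :=
    { refl := fun _ => (stableRel_fullSubcategory_iff hCX _ _).2 (stableRel_refl hC.nonempty _)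
      symm := fun h => h.symm
      trans := fun h₁ h₂ => (stableRel_fullSubcategory_iff hCX _ _).2
        (((stableRel_fullSubcategory_iff hCX _ _).1 h₁).trans hC.biprod
          ((stableRel_fullSubcategory_iff hCX _ _).1 h₂)) }

/-- Equality of morphisms in the stable category of a full subcategory. -/
lemma IsStableIdeal.functor_map_eq_iff [HasBinaryBiproducts A] (hC : IsStableIdeal C)
    {X : ObjectProperty A} (hCX : C ≤ X) {M N : X.FullSubcategory} (f g : M ⟶ N) :
    (Quotient.functor (stableRel (C.inverseImage X.ι))).map f =
      (Quotient.functor (stableRel (C.inverseImage X.ι))).map g ↔ stableRel C f.hom g.hom := by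
  have := hC.congruence hCX
  rw [Quotient.functor_map_eq_iff, stableRel_fullSubcategory_iff hCX]

variable [HasBinaryBiproducts A]

/-- A functor inverting the projections `M ⊞ c ⟶ M` with `c` in `C` identifies stably
equivalent morphisms. -/
lemma map_eq_of_stableRel {H : Type u'} [Category.{v'} H] (L : A ⥤ H)
    (hL : ∀ M c : A, C c → IsIso (L.map (biprod.fst : M ⊞ c ⟶ M)))
    {M N : A} {f g : M ⟶ N} (h : stableRel C f g) : L.map f = L.map g := by
  obtain ⟨c, hc, a, b, e⟩ := h
  have := hL M c hc
  -- Both morphisms are sections of a projection that `L` inverts, so `L` cannot tell them apart. No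
  -- additivity of `L` is needed.
  have key : L.map (biprod.lift (𝟙 M) a) = L.map (biprod.lift (𝟙 M) (0 : M ⟶ c)) := by
    rw [← cancel_mono (L.map (biprod.fst : M ⊞ c ⟶ M)), ← L.map_comp, ← L.map_comp]
    simp
  have hf : f = biprod.lift (𝟙 M) a ≫ biprod.desc g b := by
    rw [biprod.lift_desc, ← e]; simp
  have hg : g = biprod.lift (𝟙 M) (0 : M ⟶ c) ≫ biprod.desc g b := by
    rw [biprod.lift_desc]; simp
  rw [hf]
  conv_rhs => rw [hg]
  rw [L.map_comp, L.map_comp, key]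

/-- Mutually inverse stable equivalences become an isomorphism after adding objects of `C`. -/
lemma IsStableIdeal.exists_biprod_iso {A : Type u} [Category.{v} A] [Abelian A]
    {C : ObjectProperty A} (hC : IsStableIdeal C)
    {M N : A} (f : M ⟶ N) (g : N ⟶ M)
    (hfg : stableRel C (f ≫ g) (𝟙 M)) (hgf : stableRel C (g ≫ f) (𝟙 N)) :
    ∃ P F : A, C P ∧ C F ∧ Nonempty (M ⊞ P ≅ N ⊞ F) := by
  obtain ⟨c, hc, a, b, e⟩ := hfg
  obtain ⟨d, hd, a', b', e'⟩ := hgf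
  -- Enlarging `N` by `c` absorbs the error `f ≫ g - 𝟙 M = a ≫ b`, so that `M` becomes an honest
  -- direct summand of `N ⊞ c`. It remains to see that the complement `K` is in `C`.
  let s : M ⟶ N ⊞ c := biprod.lift f a
  let r : N ⊞ c ⟶ M := biprod.desc g (-b)
  have hsr : s ≫ r = 𝟙 M := by
    rw [biprod.lift_desc, Preadditive.comp_neg, ← e]; abel
  let K := kernel r
  let t : N ⊞ c ⟶ K := kernel.lift r (𝟙 _ - r ≫ s) (by
    rw [Preadditive.sub_comp, Category.assoc, hsr]; simp)
  have ht : t ≫ kernel.ι r = 𝟙 _ - r ≫ s := kernel.lift_ι _ _ _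
  have hι : kernel.ι r ≫ t = 𝟙 K := by
    rw [← cancel_mono (kernel.ι r), Category.assoc, ht, Preadditive.comp_sub,
      kernel.condition_assoc, zero_comp, sub_zero, Category.comp_id, Category.id_comp]
  have hst : s ≫ t = 0 := by
    rw [← cancel_mono (kernel.ι r), Category.assoc, ht, Preadditive.comp_sub,
      ← Category.assoc s r s, hsr]
    simp
  have hrel : stableRel C (r ≫ s) (𝟙 (N ⊞ c)) := by
    have h₁ : stableRel C (r ≫ s) (biprod.fst ≫ g ≫ f ≫ biprod.inl) := by
      refine ⟨c ⊞ c, hC.biprod _ _ hc hc,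
        biprod.lift biprod.snd (biprod.fst ≫ g ≫ a), biprod.desc (-b ≫ s) biprod.inr, ?_⟩
      apply biprod.hom_ext <;> apply biprod.hom_ext' <;> simp [r, s]
    have h₂ : stableRel C (biprod.fst ≫ (g ≫ f) ≫ (biprod.inl : N ⟶ N ⊞ c))
        ((biprod.fst : N ⊞ c ⟶ N) ≫ 𝟙 N ≫ biprod.inl) :=
      ((show stableRel C (g ≫ f) (𝟙 N) from ⟨d, hd, a', b', e'⟩).postcomp _).precomp _
    have h₃ : stableRel C ((biprod.fst : N ⊞ c ⟶ N) ≫ 𝟙 N ≫ biprod.inl) (𝟙 (N ⊞ c)) :=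
      ⟨c, hc, -biprod.snd, biprod.inr, by
        rw [← biprod.total, Category.id_comp, Preadditive.neg_comp]; abel⟩
    simp only [Category.assoc] at h₂
    exact (h₁.trans hC.biprod h₂).trans hC.biprod h₃
  -- The projection onto `K` is `𝟙 - r ≫ s`, which factors through an object `l` of `C`; hence `K`
  -- is a retract of `l`.
  have hK : C K := by
    obtain ⟨l, hl, x, y, exy⟩ := hrel
    refine hC.retract (-(kernel.ι r) ≫ x) (y ≫ t) ?_ hl
    have : -(kernel.ι r) ≫ (x ≫ y) ≫ t = 𝟙 K := by
      rw [← exy]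
      simp [hst, hι]
    simpa using this
  refine ⟨K, c, hK, hc, ⟨?_⟩⟩
  refine
    { hom := biprod.desc s (kernel.ι r)
      inv := biprod.lift r t
      hom_inv_id := ?_
      inv_hom_id := ?_ }
  · apply biprod.hom_ext <;> apply biprod.hom_ext' <;> simp [hsr, hst, hι]
  · rw [biprod.lift_desc, ht]; abel

end Stable

end Cotorsion

namespace Cotorsion

/-! ### Comparison of the stable category with the localization. -/

section Localization

variable {A : Type u} [Category.{v} A] [Preadditive A] [HasBinaryBiproducts A]
  {X C : ObjectProperty A} {W : MorphismProperty A}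

lemma isIso_Q_map_biprod_fst (hfst : ∀ M c : A, C c → W (biprod.fst : M ⊞ c ⟶ M))
    (M c : A) (hc : C c) : IsIso (W.Q.map (biprod.fst : M ⊞ c ⟶ M)) :=
  Localization.inverts W.Q W _ (hfst M c hc)

/-- The functor from the stable category of `X` to the localization. -/
noncomputable def stableToLocalization (hCX : C ≤ X)
    (hfst : ∀ M c : A, C c → W (biprod.fst : M ⊞ c ⟶ M)) :
    StableCategory X.FullSubcategory (C.inverseImage X.ι) ⥤ W.Localization :=
  CategoryTheory.Quotient.lift _ (X.ι ⋙ W.Q) fun _ _ _ _ h =>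
    map_eq_of_stableRel W.Q (isIso_Q_map_biprod_fst hfst)
      ((stableRel_fullSubcategory_iff hCX _ _).1 h)

/-- A functor from `A` to the stable category of `X` that inverts `W`, restricts to the quotient
functor, and lifts the localization functor, exhibits the stable category as the localization. -/
theorem exists_equivalence_of_functor (hCX : C ≤ X)
    (hfst : ∀ M c : A, C c → W (biprod.fst : M ⊞ c ⟶ M))
    (F : A ⥤ StableCategory X.FullSubcategory (C.inverseImage X.ι)) (hF : W.IsInvertedBy F)
    (a : X.ι ⋙ F ≅ Quotient.functor _) (b : F ⋙ stableToLocalization hCX hfst ≅ W.Q) :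
    ∃ E : StableCategory X.FullSubcategory (C.inverseImage X.ι) ≌ W.Localization,
      Nonempty (Quotient.functor _ ⋙ E.functor ≅ X.ι ⋙ W.Q) := by
  let G := stableToLocalization (X := X) (W := W) hCX hfst
  let F' : W.Localization ⥤ StableCategory X.FullSubcategory (C.inverseImage X.ι) :=
    Localization.lift F hF W.Q
  let φ : W.Q ⋙ F' ≅ F := Localization.fac F hF W.Q
  -- Each composite is compared with the identity after precomposition with the universal functor:
  -- the quotient functor here, the localization functor for `e₂`.
  let e₁ : G ⋙ F' ≅ 𝟭 _ := CategoryTheory.Quotient.natIsoLift _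
    (show Quotient.functor _ ⋙ G ⋙ F' ≅ Quotient.functor _ ⋙ 𝟭 _ from
      (Functor.isoWhiskerLeft X.ι φ ≪≫ a : X.ι ⋙ W.Q ⋙ F' ≅ Quotient.functor _))
  let e₂ : F' ⋙ G ≅ 𝟭 _ := Localization.liftNatIso W.Q W (F ⋙ G) W.Q (F' ⋙ G) (𝟭 _) b
  exact ⟨CategoryTheory.Equivalence.mk G F' e₁.symm e₂,
    ⟨(Iso.refl _ : Quotient.functor _ ⋙ G ≅ X.ι ⋙ W.Q)⟩⟩

/-- Under an equivalence of the stable category of `X` with the localization, objects of `X` are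
isomorphic in the localization iff they become isomorphic after adding objects of `C`. -/
theorem nonempty_iso_Q_iff {A : Type u} [Category.{v} A] [Abelian A]
    {X C : ObjectProperty A} {W : MorphismProperty A} (hC : IsStableIdeal C) (hCX : C ≤ X)
    (hfst : ∀ M c : A, C c → W (biprod.fst : M ⊞ c ⟶ M))
    (E : StableCategory X.FullSubcategory (C.inverseImage X.ι) ≌ W.Localization)
    (e : Quotient.functor _ ⋙ E.functor ≅ X.ι ⋙ W.Q) {M N : A} (hM : X M) (hN : X N) :
    Nonempty (W.Q.obj M ≅ W.Q.obj N) ↔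
      ∃ P F : A, C P ∧ C F ∧ Nonempty (M ⊞ P ≅ N ⊞ F) := by
  constructor
  · rintro ⟨i⟩
    let M' : X.FullSubcategory := ⟨M, hM⟩
    let N' : X.FullSubcategory := ⟨N, hN⟩
    let π := Quotient.functor (stableRel (C.inverseImage X.ι))
    let j : π.obj M' ≅ π.obj N' := E.functor.preimageIso (e.app M' ≪≫ i ≪≫ (e.app N').symm)
    obtain ⟨f, hf⟩ := π.map_surjective j.hom
    obtain ⟨g, hg⟩ := π.map_surjective j.inv
    refine hC.exists_biprod_iso f.hom g.hom ?_ ?_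
    · have := (hC.functor_map_eq_iff hCX (f ≫ g) (𝟙 M')).1 (by
        rw [Functor.map_comp, CategoryTheory.Functor.map_id, hf, hg, j.hom_inv_id])
      exact this
    · have := (hC.functor_map_eq_iff hCX (g ≫ f) (𝟙 N')).1 (by
        rw [Functor.map_comp, CategoryTheory.Functor.map_id, hf, hg, j.inv_hom_id])
      exact this
  · rintro ⟨P, F, hP, hF, ⟨i⟩⟩
    have := isIso_Q_map_biprod_fst hfst M P hP
    have := isIso_Q_map_biprod_fst hfst N F hF
    exact ⟨(asIso (W.Q.map (biprod.fst : M ⊞ P ⟶ M))).symm ≪≫ W.Q.mapIso i ≪≫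
      asIso (W.Q.map (biprod.fst : N ⊞ F ⟶ N))⟩

end Localization

/-! ### Approximations as (co)reflections up to stable equivalence. -/

section Colocal

variable {A : Type u} [Category.{v} A] [Preadditive A] {X C : ObjectProperty A}

/-- Postcomposition with `f` is bijective on stable morphisms out of objects of `X`. -/
structure IsStablyColocal (X C : ObjectProperty A) {M N : A} (f : M ⟶ N) : Prop where
  surj : ∀ T, X T → ∀ g : T ⟶ N, ∃ h : T ⟶ M, stableRel C (h ≫ f) g
  inj : ∀ T, X T → ∀ h h' : T ⟶ M, stableRel C (h ≫ f) (h' ≫ f) → stableRel C h h'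

/-- Precomposition with `f` is bijective on stable morphisms into objects of `X`. -/
structure IsStablyLocal (X C : ObjectProperty A) {M N : A} (f : M ⟶ N) : Prop where
  surj : ∀ T, X T → ∀ g : M ⟶ T, ∃ h : N ⟶ T, stableRel C (f ≫ h) g
  inj : ∀ T, X T → ∀ h h' : N ⟶ T, stableRel C (f ≫ h) (f ≫ h') → stableRel C h h'

lemma IsStablyColocal.of_retraction {M N : A} {i : M ⟶ N} {r : N ⟶ M} (hir : i ≫ r = 𝟙 M)
    (hri : stableRel C (r ≫ i) (𝟙 N)) : IsStablyColocal X C i where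
  surj T _ g := ⟨g ≫ r, by simpa using hri.precomp g⟩
  inj T _ h h' H := by simpa [hir] using H.postcomp r

lemma IsStablyLocal.of_section {M N : A} {i : M ⟶ N} {r : N ⟶ M} (hir : i ≫ r = 𝟙 M)
    (hri : stableRel C (r ≫ i) (𝟙 N)) : IsStablyLocal X C r where
  surj T _ g := ⟨i ≫ g, by simpa using hri.postcomp g⟩
  inj T _ h h' H := by
    have := H.precomp i
    rwa [← Category.assoc, ← Category.assoc, hir, Category.id_comp, Category.id_comp] at this

variable [HasBinaryBiproducts A]

lemma IsStablyColocal.comp (hC : IsStableIdeal C) {L M N : A} {f : L ⟶ M} {g : M ⟶ N}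
    (hf : IsStablyColocal X C f) (hg : IsStablyColocal X C g) :
    IsStablyColocal X C (f ≫ g) where
  surj T hT k := by
    obtain ⟨h, hh⟩ := hg.surj T hT k
    obtain ⟨h', hh'⟩ := hf.surj T hT h
    refine ⟨h', ?_⟩
    rw [← Category.assoc]
    exact (hh'.postcomp g).trans hC.biprod hh
  inj T hT h h' H := by
    rw [← Category.assoc, ← Category.assoc] at H
    exact hf.inj T hT _ _ (hg.inj T hT _ _ H)

lemma IsStablyLocal.comp (hC : IsStableIdeal C) {L M N : A} {f : L ⟶ M} {g : M ⟶ N}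
    (hf : IsStablyLocal X C f) (hg : IsStablyLocal X C g) :
    IsStablyLocal X C (f ≫ g) where
  surj T hT k := by
    obtain ⟨h, hh⟩ := hf.surj T hT k
    obtain ⟨h', hh'⟩ := hg.surj T hT h
    refine ⟨h', ?_⟩
    rw [Category.assoc]
    exact (hh'.precomp f).trans hC.biprod hh
  inj T hT h h' H := by
    rw [Category.assoc, Category.assoc] at H
    exact hg.inj T hT _ _ (hf.inj T hT _ _ H)

variable {W : MorphismProperty A}

/-- The morphisms `p M` behave like a coreflection into `X` up to stable equivalence, so `M ↦ R M`
is functorial with values in the stable category, although the approximations and the lifts `ρ` are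
arbitrary choices. -/
theorem exists_equivalence_of_colocal (hC : IsStableIdeal C) (hCX : C ≤ X)
    (hfst : ∀ M c : A, C c → W (biprod.fst : M ⊞ c ⟶ M))
    (hW : ∀ {M N : A} (f : M ⟶ N), W f → IsStablyColocal X C f)
    (hex : ∀ M : A, ∃ (M' : A) (p : M' ⟶ M), X M' ∧ W p) :
    ∃ E : StableCategory X.FullSubcategory (C.inverseImage X.ι) ≌ W.Localization,
      Nonempty (Quotient.functor _ ⋙ E.functor ≅ X.ι ⋙ W.Q) := by
  choose R p hR hWp using hex
  have hp := fun M => hW _ (hWp M)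
  have heq : ∀ {M N : X.FullSubcategory} (f g : M ⟶ N), stableRel C f.hom g.hom →
      (Quotient.functor (stableRel (C.inverseImage X.ι))).map f =
      (Quotient.functor (stableRel (C.inverseImage X.ι))).map g := fun f g h =>
    (hC.functor_map_eq_iff hCX f g).2 h
  choose ρ hρ using fun {M N : A} (f : M ⟶ N) => (hp N).surj _ (hR M) (p M ≫ f)
  let F : A ⥤ StableCategory X.FullSubcategory (C.inverseImage X.ι) :=
    { obj := fun M => (Quotient.functor _).obj ⟨R M, hR M⟩
      map := fun f => (Quotient.functor _).map (ObjectProperty.homMk (ρ f))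
      map_id := fun M => by
        rw [← CategoryTheory.Functor.map_id]
        refine heq _ _ ((hp M).inj _ (hR M) _ _ ?_)
        simpa using hρ (𝟙 M)
      map_comp := fun {M N L} f g => by
        rw [← Functor.map_comp]
        refine heq _ _ ((hp L).inj _ (hR M) _ _ ?_)
        refine (hρ (f ≫ g)).trans hC.biprod ?_
        have h₁ := (hρ f).symm.postcomp g
        have h₂ := (hρ g).symm.precomp (ρ f)
        simp only [Category.assoc] at h₁ h₂
        simpa using h₁.trans hC.biprod h₂ }
  have hFiso : ∀ {M N : A} (f : M ⟶ N), IsStablyColocal X C f → IsIso (F.map f) := by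
    intro M N f hf
    -- `p M ≫ f` is colocal as well, so both it and `p N` present `N`; the lift of `p N` along it is
    -- the inverse of `ρ f`.
    have hpf := (hp M).comp hC hf
    obtain ⟨k, hk⟩ := hpf.surj _ (hR N) (p N)
    refine ⟨(Quotient.functor _).map (ObjectProperty.homMk k), ?_, ?_⟩
    · dsimp only [F]
      rw [← Functor.map_comp, ← CategoryTheory.Functor.map_id]
      refine heq _ _ (hpf.inj _ (hR M) _ _ ?_)
      have h₁ := hk.precomp (ρ f)
      simpa using h₁.trans hC.biprod (hρ f)
    · dsimp only [F]
      rw [← Functor.map_comp, ← CategoryTheory.Functor.map_id]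
      refine heq _ _ ((hp N).inj _ (hR N) _ _ ?_)
      have h₁ := (hρ f).precomp k
      simpa using h₁.trans hC.biprod hk
  -- For `M` already in `X`, lifting the identity along `p M` gives a stable inverse.
  have hX : ∀ M : X.FullSubcategory, IsIso ((Quotient.functor
      (stableRel (C.inverseImage X.ι))).map
        (ObjectProperty.homMk (p M.obj) : (⟨R M.obj, hR M.obj⟩ : X.FullSubcategory) ⟶ M)) := by
    intro M
    obtain ⟨k, hk⟩ := (hp M.obj).surj _ M.property (𝟙 M.obj)
    refine ⟨(Quotient.functor _).map (ObjectProperty.homMk k), ?_, ?_⟩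
    · rw [← Functor.map_comp, ← CategoryTheory.Functor.map_id]
      refine heq _ _ ((hp M.obj).inj _ (hR M.obj) _ _ ?_)
      simpa using hk.precomp (p M.obj)
    · rw [← Functor.map_comp, ← CategoryTheory.Functor.map_id]
      exact heq _ _ hk
  refine exists_equivalence_of_functor hCX hfst F (fun M N f hf => hFiso f (hW f hf))
    (NatIso.ofComponents (fun M => @asIso _ _ _ _ _ (hX M)) ?_)
    (NatIso.ofComponents
      (fun M => @asIso _ _ _ _ (W.Q.map (p M)) (Localization.inverts W.Q W _ (hWp M))) ?_)
  · intro M N f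
    dsimp [F]
    rw [← Functor.map_comp, ← Functor.map_comp]
    exact heq _ _ (hρ f.hom)
  · intro M N f
    change W.Q.map (ρ f) ≫ W.Q.map (p N) = W.Q.map (p M) ≫ W.Q.map f
    rw [← Functor.map_comp, ← Functor.map_comp]
    exact map_eq_of_stableRel W.Q (isIso_Q_map_biprod_fst hfst) (hρ f)

/-- The dual argument, with a reflection in place of a coreflection. The condition `hfst` is not
dualized: it serves only to make stably equivalent morphisms equal in the localization, and
projections with injective kernel are also injective weak equivalences. -/
theorem exists_equivalence_of_local (hC : IsStableIdeal C) (hCX : C ≤ X)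
    (hfst : ∀ M c : A, C c → W (biprod.fst : M ⊞ c ⟶ M))
    (hW : ∀ {M N : A} (f : M ⟶ N), W f → IsStablyLocal X C f)
    (hex : ∀ M : A, ∃ (M' : A) (p : M ⟶ M'), X M' ∧ W p) :
    ∃ E : StableCategory X.FullSubcategory (C.inverseImage X.ι) ≌ W.Localization,
      Nonempty (Quotient.functor _ ⋙ E.functor ≅ X.ι ⋙ W.Q) := by
  choose R p hR hWp using hex
  have hp := fun M => hW _ (hWp M)
  have heq : ∀ {M N : X.FullSubcategory} (f g : M ⟶ N), stableRel C f.hom g.hom →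
      (Quotient.functor (stableRel (C.inverseImage X.ι))).map f =
      (Quotient.functor (stableRel (C.inverseImage X.ι))).map g := fun f g h =>
    (hC.functor_map_eq_iff hCX f g).2 h
  choose ρ hρ using fun {M N : A} (f : M ⟶ N) => (hp M).surj _ (hR N) (f ≫ p N)
  let F : A ⥤ StableCategory X.FullSubcategory (C.inverseImage X.ι) :=
    { obj := fun M => (Quotient.functor _).obj ⟨R M, hR M⟩
      map := fun f => (Quotient.functor _).map (ObjectProperty.homMk (ρ f))
      map_id := fun M => by
        rw [← CategoryTheory.Functor.map_id]
        refine heq _ _ ((hp M).inj _ (hR M) _ _ ?_)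
        simpa using hρ (𝟙 M)
      map_comp := fun {M N L} f g => by
        rw [← Functor.map_comp]
        refine heq _ _ ((hp M).inj _ (hR L) _ _ ?_)
        refine (hρ (f ≫ g)).trans hC.biprod ?_
        have h₁ := (hρ g).symm.precomp f
        have h₂ := (hρ f).symm.postcomp (ρ g)
        simp only [Category.assoc] at h₁ h₂
        simpa using h₁.trans hC.biprod h₂ }
  have hFiso : ∀ {M N : A} (f : M ⟶ N), IsStablyLocal X C f → IsIso (F.map f) := by
    intro M N f hf
    have hpf := hf.comp hC (hp N)
    obtain ⟨k, hk⟩ := hpf.surj _ (hR M) (p M)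
    refine ⟨(Quotient.functor _).map (ObjectProperty.homMk k), ?_, ?_⟩
    · dsimp only [F]
      rw [← Functor.map_comp, ← CategoryTheory.Functor.map_id]
      refine heq _ _ ((hp M).inj _ (hR M) _ _ ?_)
      have h₁ := (hρ f).postcomp k
      simpa using h₁.trans hC.biprod (by simpa using hk)
    · dsimp only [F]
      rw [← Functor.map_comp, ← CategoryTheory.Functor.map_id]
      refine heq _ _ (hpf.inj _ (hR N) _ _ ?_)
      have h₁ := hk.postcomp (ρ f)
      simpa using h₁.trans hC.biprod (hρ f)
  have hX : ∀ M : X.FullSubcategory, IsIso ((Quotient.functor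
      (stableRel (C.inverseImage X.ι))).map
        (ObjectProperty.homMk (p M.obj) : M ⟶ (⟨R M.obj, hR M.obj⟩ : X.FullSubcategory))) := by
    intro M
    obtain ⟨k, hk⟩ := (hp M.obj).surj _ M.property (𝟙 M.obj)
    refine ⟨(Quotient.functor _).map (ObjectProperty.homMk k), ?_, ?_⟩
    · rw [← Functor.map_comp, ← CategoryTheory.Functor.map_id]
      exact heq _ _ hk
    · rw [← Functor.map_comp, ← CategoryTheory.Functor.map_id]
      refine heq _ _ ((hp M.obj).inj _ (hR M.obj) _ _ ?_)
      simpa using hk.postcomp (p M.obj)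
  refine exists_equivalence_of_functor hCX hfst F (fun M N f hf => hFiso f (hW f hf))
    (NatIso.ofComponents (fun M => @asIso _ _ _ _ _ (hX M)) ?_).symm
    (NatIso.ofComponents (F := W.Q) (G := F ⋙ stableToLocalization hCX hfst)
      (fun M => @asIso _ _ _ _ (W.Q.map (p M)) (Localization.inverts W.Q W _ (hWp M))) ?_).symm
  · intro M N f
    dsimp [F]
    rw [← Functor.map_comp, ← Functor.map_comp]
    exact heq _ _ (hρ f.hom).symm
  · intro M N f
    change W.Q.map f ≫ W.Q.map (p N) = W.Q.map (p M) ≫ W.Q.map (ρ f)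
    rw [← Functor.map_comp, ← Functor.map_comp]
    exact (map_eq_of_stableRel W.Q (isIso_Q_map_biprod_fst hfst) (hρ f)).symm

end Colocal

end Cotorsion

namespace Cotorsion

/-! ### Lifting and extension from vanishing of `Ext¹`. -/

section Ext

variable {A : Type u} [Category.{v} A] [Abelian A] [HasExt.{w} A]

lemma exists_lift_of_subsingleton_ext {S : ShortComplex A} (hS : S.ShortExact) {T : A}
    (h : Subsingleton (Abelian.Ext.{w} T S.X₁ 1)) (g : T ⟶ S.X₃) :
    ∃ k : T ⟶ S.X₂, k ≫ S.g = g := by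
  obtain ⟨x, hx⟩ := Abelian.Ext.covariant_sequence_exact₃ T hS (Abelian.Ext.mk₀ g)
    (zero_add 1) (Subsingleton.elim _ _)
  obtain ⟨k, rfl⟩ := (Abelian.Ext.mk₀_bijective _ _).surjective x
  rw [Abelian.Ext.mk₀_comp_mk₀] at hx
  exact ⟨k, (Abelian.Ext.mk₀_bijective _ _).injective hx⟩

lemma exists_extension_of_subsingleton_ext {S : ShortComplex A} (hS : S.ShortExact) {T : A}
    (h : Subsingleton (Abelian.Ext.{w} S.X₃ T 1)) (g : S.X₁ ⟶ T) :
    ∃ k : S.X₂ ⟶ T, S.f ≫ k = g := by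
  obtain ⟨x, hx⟩ := Abelian.Ext.contravariant_sequence_exact₁ hS T (Abelian.Ext.mk₀ g)
    (add_zero 1) (Subsingleton.elim _ _)
  obtain ⟨k, rfl⟩ := (Abelian.Ext.mk₀_bijective _ _).surjective x
  rw [Abelian.Ext.mk₀_comp_mk₀] at hx
  exact ⟨k, (Abelian.Ext.mk₀_bijective _ _).injective hx⟩

lemma rightPerp_of_retract {P : ObjectProperty A} {M N : A} (i : N ⟶ M) (r : M ⟶ N)
    (hir : i ≫ r = 𝟙 N) (hM : rightPerp.{w} P M) : rightPerp.{w} P N := by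
  intro X hX
  have := hM X hX
  refine subsingleton_of_forall_eq 0 fun x => ?_
  rw [← Abelian.Ext.comp_mk₀_id x, ← hir, ← Abelian.Ext.mk₀_comp_mk₀,
    ← Abelian.Ext.comp_assoc_of_second_deg_zero,
    Subsingleton.elim (x.comp (Abelian.Ext.mk₀ i) (add_zero 1)) 0, Abelian.Ext.zero_comp]

end Ext

/-! ### Stable bijectivity of monomorphisms and epimorphisms. -/

section Abelian

variable {A : Type u} [Category.{v} A] [Abelian A]

lemma shortExact_kernel {M N : A} (p : M ⟶ N) [Epi p] :
    (ShortComplex.mk (kernel.ι p) p (kernel.condition p)).ShortExact where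
  exact := ShortComplex.exact_of_f_is_kernel _ (kernelIsKernel p)

lemma shortExact_cokernel {M N : A} (i : M ⟶ N) [Mono i] :
    (ShortComplex.mk i (cokernel.π i) (cokernel.condition i)).ShortExact where
  exact := ShortComplex.exact_of_g_is_cokernel _ (cokernelIsCokernel i)

lemma isStableIdeal_isProjective : IsStableIdeal (isProjective A) where
  nonempty := ⟨_, (isZero_zero A).projective⟩
  biprod c d hc hd := by
    have : Projective c := hc
    have : Projective d := hd
    exact (inferInstance : Projective (c ⊞ d))
  retract {c d} i r hir hc := by
    have : Projective c := hc
    exact Retract.projective (Y := c) ⟨i, r, hir⟩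

lemma isStableIdeal_isInjective : IsStableIdeal (isInjective A) where
  nonempty := ⟨_, (isZero_zero A).injective⟩
  biprod c d hc hd := by
    have : Injective c := hc
    have : Injective d := hd
    exact (inferInstance : Injective (c ⊞ d))
  retract {c d} i r hir hc := by
    have : Injective c := hc
    exact Retract.injective (Y := c) ⟨i, r, hir⟩

/-- A projective cokernel splits the sequence, and the resulting retraction is a stable inverse of
`i`. -/
lemma isStablyColocal_of_mono {X : ObjectProperty A} {M N : A} (i : M ⟶ N) [Mono i]
    [Projective (cokernel i)] : IsStablyColocal X (isProjective A) i := by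
  let S := ShortComplex.mk i (cokernel.π i) (cokernel.condition i)
  have hS : S.ShortExact := shortExact_cokernel i
  have : Projective S.X₃ := ‹Projective (cokernel i)›
  let σ := hS.splittingOfProjective
  refine IsStablyColocal.of_retraction (r := σ.r) σ.f_r ⟨S.X₃, this, -S.g, σ.s, ?_⟩
  have := σ.id
  change σ.r ≫ i - 𝟙 N = _
  change σ.r ≫ i + S.g ≫ σ.s = 𝟙 N at this
  rw [← this]
  simp

lemma isStablyLocal_of_epi {Y : ObjectProperty A} {M N : A} (p : M ⟶ N) [Epi p]
    [Injective (kernel p)] : IsStablyLocal Y (isInjective A) p := by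
  let S := ShortComplex.mk (kernel.ι p) p (kernel.condition p)
  have hS : S.ShortExact := shortExact_kernel p
  have : Injective S.X₁ := ‹Injective (kernel p)›
  let σ := hS.splittingOfInjective
  refine IsStablyLocal.of_section (i := σ.s) σ.s_g ⟨S.X₁, this, -σ.r, S.f, ?_⟩
  have := σ.id
  change p ≫ σ.s - 𝟙 M = _
  change σ.r ≫ S.f + p ≫ σ.s = 𝟙 M at this
  rw [← this]
  simp

lemma isStablyColocal_of_epi {X Z : ObjectProperty A}
    (hXZ : ∀ T K : A, X T → Z K → ∀ f : T ⟶ K,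
      ∃ (P : A) (_ : Projective P) (a : T ⟶ P) (b : P ⟶ K), f = a ≫ b)
    {M N : A} (p : M ⟶ N) [Epi p] (hp : Z (kernel p))
    (hlift : ∀ T : A, X T → ∀ g : T ⟶ N, ∃ k : T ⟶ M, k ≫ p = g) :
    IsStablyColocal X (isProjective A) p where
  surj T hT g := by
    obtain ⟨k, hk⟩ := hlift T hT g
    exact ⟨k, hk ▸ stableRel_refl isStableIdeal_isProjective.nonempty _⟩
  inj T hT h h' := by
    rintro ⟨P, hP, a, b, e⟩
    have : Projective P := hP
    let b' := Projective.factorThru b p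
    have hb : b' ≫ p = b := Projective.factorThru_comp b p
    -- Lifting `b` through `p` corrects `h - h'` to a morphism into the kernel of `p`; as that
    -- kernel is in `Z`, the correction term factors through a second projective `Q`.
    obtain ⟨Q, hQ, x, y, hxy⟩ := hXZ T _ hT hp (kernel.lift p (h - h' - a ≫ b') (by
      rw [Preadditive.sub_comp, Preadditive.sub_comp, e, Category.assoc, hb, sub_self]))
    refine ⟨P ⊞ Q, isStableIdeal_isProjective.biprod _ _ hP hQ,
      biprod.lift a x, biprod.desc b' (y ≫ kernel.ι p), ?_⟩
    rw [biprod.lift_desc, ← Category.assoc x, ← hxy, kernel.lift_ι]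
    abel

lemma isStablyLocal_of_mono {Y Z : ObjectProperty A}
    (hZY : ∀ K T : A, Z K → Y T → ∀ f : K ⟶ T,
      ∃ (I : A) (_ : Injective I) (a : K ⟶ I) (b : I ⟶ T), f = a ≫ b)
    {M N : A} (i : M ⟶ N) [Mono i] (hi : Z (cokernel i))
    (hext : ∀ T : A, Y T → ∀ g : M ⟶ T, ∃ k : N ⟶ T, i ≫ k = g) :
    IsStablyLocal Y (isInjective A) i where
  surj T hT g := by
    obtain ⟨k, hk⟩ := hext T hT g
    exact ⟨k, hk ▸ stableRel_refl isStableIdeal_isInjective.nonempty _⟩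
  inj T hT h h' := by
    rintro ⟨I, hI, a, b, e⟩
    have : Injective I := hI
    let a' := Injective.factorThru a i
    have ha : i ≫ a' = a := Injective.comp_factorThru a i
    obtain ⟨J, hJ, x, y, hxy⟩ := hZY _ T hi hT (cokernel.desc i (h - h' - a' ≫ b) (by
      rw [Preadditive.comp_sub, Preadditive.comp_sub, e, ← Category.assoc i, ha, sub_self]))
    refine ⟨I ⊞ J, isStableIdeal_isInjective.biprod _ _ hI hJ,
      biprod.lift a' (cokernel.π i ≫ x), biprod.desc b y, ?_⟩
    rw [biprod.lift_desc, Category.assoc, ← hxy, cokernel.π_desc]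
    abel

lemma weakEquivalences_of_epi {C W F : ObjectProperty A} (hC : ∀ c : A, IsZero c → C c)
    (hW : ∀ c : A, IsZero c → W c) {M N : A} (p : M ⟶ N) [Epi p] (hF : F (kernel p))
    (hp : W (kernel p)) : weakEquivalences C W F p :=
  ⟨M, 𝟙 M, p, Category.id_comp p, inferInstance, hC _ (isZero_cokernel_of_epi _),
    hW _ (isZero_cokernel_of_epi _), inferInstance, hF, hp⟩

lemma weakEquivalences_of_mono {C W F : ObjectProperty A} (hF : ∀ c : A, IsZero c → F c)
    (hW : ∀ c : A, IsZero c → W c) {M N : A} (i : M ⟶ N) [Mono i] (hC : C (cokernel i))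
    (hi : W (cokernel i)) : weakEquivalences C W F i :=
  ⟨N, i, 𝟙 N, Category.comp_id i, inferInstance, hC, hi, inferInstance,
    hF _ (isZero_kernel_of_mono _), hW _ (isZero_kernel_of_mono _)⟩

end Abelian

/-! ### Consequences of the cotorsion triple axioms. -/

namespace IsCompleteHereditaryTriple

variable {A : Type u} [Category.{v} A] [Abelian A] [HasExt.{w} A] {X Z Y : ObjectProperty A}

lemma subsingleton_ext_left (h : IsCompleteHereditaryTriple.{w} X Z Y) {T K : A} (hT : X T)
    (hK : Z K) : Subsingleton (Abelian.Ext.{w} T K 1) := by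
  have := h.pair_left.left_eq ▸ hT
  exact this K hK

lemma subsingleton_ext_right (h : IsCompleteHereditaryTriple.{w} X Z Y) {K T : A} (hK : Z K)
    (hT : Y T) : Subsingleton (Abelian.Ext.{w} K T 1) := by
  have := h.pair_right.left_eq ▸ hK
  exact this T hT

lemma left_of_projective (h : IsCompleteHereditaryTriple.{w} X Z Y) {P : A} (hP : Projective P) :
    X P := h.hereditary_left.projective_mem P hP

lemma middle_of_projective (h : IsCompleteHereditaryTriple.{w} X Z Y) {P : A}
    (hP : Projective P) : Z P := h.hereditary_right.projective_mem P hP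

lemma middle_of_injective (h : IsCompleteHereditaryTriple.{w} X Z Y) {I : A}
    (hI : Injective I) : Z I := by
  rw [h.pair_left.right_eq]
  -- The index `0` refers to degree `0 + 1`.
  exact fun T _ => Abelian.Ext.subsingleton_of_injective T I 0

lemma right_of_injective (h : IsCompleteHereditaryTriple.{w} X Z Y) {I : A}
    (hI : Injective I) : Y I := by
  rw [h.pair_right.right_eq]
  exact fun T _ => Abelian.Ext.subsingleton_of_injective T I 0

/-- This provides invariance of `Z` under isomorphism, needed because the chosen kernels and
cokernels are only isomorphic to the end terms of the given sequences. -/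
lemma middle_of_retract (h : IsCompleteHereditaryTriple.{w} X Z Y) {M N : A} (i : N ⟶ M)
    (r : M ⟶ N) (hir : i ≫ r = 𝟙 N) (hM : Z M) : Z N := by
  rw [h.pair_left.right_eq] at hM ⊢
  exact rightPerp_of_retract i r hir hM

/-- The middle class is closed under cokernels of monomorphisms. -/
lemma middle_X₃ [EnoughProjectives A] (h : IsCompleteHereditaryTriple.{w} X Z Y)
    {S : ShortComplex A} (hS : S.ShortExact) (h₁ : Z S.X₁) (h₂ : Z S.X₂) : Z S.X₃ := by
  rw [h.pair_left.right_eq]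
  intro T hT
  have hπ := shortExact_kernel (Projective.π T)
  have hK : X (kernel (Projective.π T)) :=
    (h.hereditary_left.mem_iff _ hπ hT).1 (h.left_of_projective (Projective.projective_over T))
  -- Dimension shift: the syzygy of `T` stays in `X` because `X` is resolving, so `Ext²(T, S.X₁)` is
  -- a quotient of a vanishing `Ext¹`. Then `Ext¹(T, S.X₃)` lies between two zero groups.
  have ext₂ : Subsingleton (Abelian.Ext.{w} T S.X₁ 2) := by
    refine subsingleton_of_forall_eq 0 fun x => ?_
    obtain ⟨y, rfl⟩ := Abelian.Ext.contravariant_sequence_exact₃ hπ S.X₁ x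
      (Abelian.Ext.eq_zero_of_projective (P := Projective.over T) _) (rfl : 1 + 1 = 2)
    have := h.subsingleton_ext_left hK h₁
    rw [Subsingleton.elim y 0, Abelian.Ext.comp_zero]
  refine subsingleton_of_forall_eq 0 fun x => ?_
  obtain ⟨y, rfl⟩ := Abelian.Ext.covariant_sequence_exact₃ T hS x (rfl : 1 + 1 = 2)
    (Subsingleton.elim _ _)
  have := h.subsingleton_ext_left hT h₂
  rw [Subsingleton.elim y 0, Abelian.Ext.zero_comp]

lemma factors_through_projective [EnoughProjectives A]
    (h : IsCompleteHereditaryTriple.{w} X Z Y) (T K : A) (hT : X T) (hK : Z K) (f : T ⟶ K) :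
    ∃ (P : A) (_ : Projective P) (a : T ⟶ P) (b : P ⟶ K), f = a ≫ b := by
  have hπ := shortExact_kernel (Projective.π K)
  have hL : Z (kernel (Projective.π K)) := (h.hereditary_right.mem_iff _ hπ hK).1
    (h.middle_of_projective (Projective.projective_over K))
  obtain ⟨k, hk⟩ := exists_lift_of_subsingleton_ext hπ (h.subsingleton_ext_left hT hL) f
  exact ⟨_, Projective.projective_over K, k, _, hk.symm⟩

/-- Dual to the projective case, with `middle_X₃` placing the cokernel of an injective embedding in
`Z`. -/
lemma factors_through_injective [EnoughProjectives A] [EnoughInjectives A]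
    (h : IsCompleteHereditaryTriple.{w} X Z Y) (K T : A) (hK : Z K) (hT : Y T) (f : K ⟶ T) :
    ∃ (I : A) (_ : Injective I) (a : K ⟶ I) (b : I ⟶ T), f = a ≫ b := by
  have hι := shortExact_cokernel (Injective.ι K)
  have hL : Z (cokernel (Injective.ι K)) :=
    h.middle_X₃ hι hK (h.middle_of_injective (Injective.injective_under K))
  obtain ⟨k, hk⟩ := exists_extension_of_subsingleton_ext hι (h.subsingleton_ext_right hL hT) f
  exact ⟨_, Injective.injective_under K, _, k, hk.symm⟩

lemma projective_of_left_of_middle [EnoughProjectives A]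
    (h : IsCompleteHereditaryTriple.{w} X Z Y) {M : A} (hX : X M) (hZ : Z M) :
    Projective M := by
  obtain ⟨P, hP, a, b, hab⟩ := h.factors_through_projective M M hX hZ (𝟙 M)
  exact isStableIdeal_isProjective.retract a b hab.symm hP

lemma injective_of_middle_of_right [EnoughProjectives A] [EnoughInjectives A]
    (h : IsCompleteHereditaryTriple.{w} X Z Y) {M : A} (hZ : Z M) (hY : Y M) :
    Injective M := by
  obtain ⟨I, hI, a, b, hab⟩ := h.factors_through_injective M M hZ hY (𝟙 M)
  exact isStableIdeal_isInjective.retract a b hab.symm hI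

lemma isStablyColocal_of_epi [EnoughProjectives A]
    (h : IsCompleteHereditaryTriple.{w} X Z Y) {M N : A} (p : M ⟶ N) [Epi p]
    (hp : Z (kernel p)) : IsStablyColocal X (isProjective A) p :=
  Cotorsion.isStablyColocal_of_epi h.factors_through_projective p hp fun _ hT g =>
    exists_lift_of_subsingleton_ext (shortExact_kernel p) (h.subsingleton_ext_left hT hp) g

lemma isStablyLocal_of_mono [EnoughProjectives A] [EnoughInjectives A]
    (h : IsCompleteHereditaryTriple.{w} X Z Y) {M N : A} (i : M ⟶ N) [Mono i]
    (hi : Z (cokernel i)) : IsStablyLocal Y (isInjective A) i :=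
  Cotorsion.isStablyLocal_of_mono h.factors_through_injective i hi fun _ hT g =>
    exists_extension_of_subsingleton_ext (shortExact_cokernel i)
      (h.subsingleton_ext_right hi hT) g

lemma isStablyColocal_of_projectiveWeakEquivalences [EnoughProjectives A]
    (h : IsCompleteHereditaryTriple.{w} X Z Y) {M N : A} (f : M ⟶ N)
    (hf : projectiveWeakEquivalences X Z f) : IsStablyColocal X (isProjective A) f := by
  obtain ⟨L, i, p, rfl, _, hX, hZ, _, -, hp⟩ := hf
  have := h.projective_of_left_of_middle hX hZ
  exact (isStablyColocal_of_mono i).comp isStableIdeal_isProjective (h.isStablyColocal_of_epi p hp)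

lemma isStablyLocal_of_injectiveWeakEquivalences [EnoughProjectives A] [EnoughInjectives A]
    (h : IsCompleteHereditaryTriple.{w} X Z Y) {M N : A} (f : M ⟶ N)
    (hf : injectiveWeakEquivalences Z Y f) : IsStablyLocal Y (isInjective A) f := by
  obtain ⟨L, i, p, rfl, _, -, hi, _, hY, hZ⟩ := hf
  have := h.injective_of_middle_of_right hZ hY
  exact (h.isStablyLocal_of_mono i hi).comp isStableIdeal_isInjective (isStablyLocal_of_epi p)

lemma projectiveWeakEquivalences_of_epi (h : IsCompleteHereditaryTriple.{w} X Z Y) {M N : A}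
    (p : M ⟶ N) [Epi p] (hp : Z (kernel p)) : projectiveWeakEquivalences X Z p :=
  weakEquivalences_of_epi (fun _ hc => h.left_of_projective hc.projective)
    (fun _ hc => h.middle_of_projective hc.projective) p trivial hp

lemma injectiveWeakEquivalences_of_mono (h : IsCompleteHereditaryTriple.{w} X Z Y) {M N : A}
    (i : M ⟶ N) [Mono i] (hi : Z (cokernel i)) : injectiveWeakEquivalences Z Y i :=
  weakEquivalences_of_mono (fun _ hc => h.right_of_injective hc.injective)
    (fun _ hc => h.middle_of_injective hc.injective) i trivial hi

lemma projectiveWeakEquivalences_biprod_fst (h : IsCompleteHereditaryTriple.{w} X Z Y)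
    (M c : A) (hc : isProjective A c) :
    projectiveWeakEquivalences X Z (biprod.fst : M ⊞ c ⟶ M) :=
  h.projectiveWeakEquivalences_of_epi _ (h.middle_of_projective
    (isStableIdeal_isProjective.retract kernelBiprodFstIso.hom kernelBiprodFstIso.inv
      (Iso.hom_inv_id _) hc))

lemma injectiveWeakEquivalences_biprod_fst (h : IsCompleteHereditaryTriple.{w} X Z Y)
    (M c : A) (hc : isInjective A c) :
    injectiveWeakEquivalences Z Y (biprod.fst : M ⊞ c ⟶ M) := by
  have hk : Injective (kernel (biprod.fst : M ⊞ c ⟶ M)) :=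
    isStableIdeal_isInjective.retract kernelBiprodFstIso.hom kernelBiprodFstIso.inv
      (Iso.hom_inv_id _) hc
  exact weakEquivalences_of_epi (fun _ _ => trivial)
    (fun _ hz => h.middle_of_injective hz.injective) _ (h.right_of_injective hk)
    (h.middle_of_injective hk)

lemma projectiveWeakEquivalences_of_approximation (h : IsCompleteHereditaryTriple.{w} X Z Y)
    {M' M : A} {f : M' ⟶ M} (hf : IsSpecialRightApproximation.{w} X f) :
    projectiveWeakEquivalences X Z f := by
  have := hf.epi
  refine h.projectiveWeakEquivalences_of_epi f ?_
  rw [h.pair_left.right_eq]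
  exact hf.kernel_mem

lemma injectiveWeakEquivalences_of_approximation (h : IsCompleteHereditaryTriple.{w} X Z Y)
    {M M' : A} {f : M ⟶ M'} (hf : IsSpecialLeftApproximation.{w} Y f) :
    injectiveWeakEquivalences Z Y f := by
  have := hf.mono
  refine h.injectiveWeakEquivalences_of_mono f ?_
  rw [h.pair_right.left_eq]
  exact hf.cokernel_mem

lemma exists_specialRightApproximation (h : IsCompleteHereditaryTriple.{w} X Z Y) (M : A) :
    ∃ (M' : A) (f : M' ⟶ M), IsSpecialRightApproximation.{w} X f := by
  obtain ⟨K, E, i, p, w, hS, hK, hE⟩ := h.complete_left.exists_left M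
  have hp : Epi p := hS.epi_g
  have hi : Mono i := hS.mono_f
  have e : kernel p ≅ K := (limit.isLimit _).conePointUniqueUpToIso hS.fIsKernel
  refine ⟨E, p, ⟨hE, fun T hT g => ?_⟩, hp, ?_⟩
  · exact exists_lift_of_subsingleton_ext hS (h.subsingleton_ext_left hT hK) g
  · rw [← h.pair_left.right_eq]
    exact h.middle_of_retract e.hom e.inv e.hom_inv_id hK

lemma exists_specialLeftApproximation (h : IsCompleteHereditaryTriple.{w} X Z Y) (M : A) :
    ∃ (M' : A) (f : M ⟶ M'), IsSpecialLeftApproximation.{w} Y f := by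
  obtain ⟨E, C, i, p, w, hS, hE, hC⟩ := h.complete_right.exists_right M
  have hp : Epi p := hS.epi_g
  have hi : Mono i := hS.mono_f
  have e : cokernel i ≅ C := (colimit.isColimit _).coconePointUniqueUpToIso hS.gIsCokernel
  refine ⟨E, i, ⟨hE, fun T hT g => ?_⟩, hi, ?_⟩
  · exact exists_extension_of_subsingleton_ext hS (h.subsingleton_ext_right hC hT) g
  · rw [← h.pair_right.left_eq]
    exact h.middle_of_retract e.hom e.inv e.hom_inv_id hC

/-- The approximations become isomorphisms in the localization, so they may replace `M` and `N`. As
`f` and `g` are arbitrary, this one statement yields both the existential and the universal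
criterion. -/
theorem nonempty_iso_Q_iff_of_rightApproximation
    (h : IsCompleteHereditaryTriple.{w} X Z Y)
    (E : ModProjectives X ≌ (projectiveWeakEquivalences X Z).Localization)
    (e : Quotient.functor _ ⋙ E.functor ≅ X.ι ⋙ (projectiveWeakEquivalences X Z).Q)
    {M N M' N' : A} {f : M' ⟶ M} {g : N' ⟶ N} (hf : IsSpecialRightApproximation.{w} X f)
    (hg : IsSpecialRightApproximation.{w} X g) :
    Nonempty (E.inverse.obj ((projectiveWeakEquivalences X Z).Q.obj M) ≅
      E.inverse.obj ((projectiveWeakEquivalences X Z).Q.obj N)) ↔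
      ∃ P F : A, Projective P ∧ Projective F ∧ Nonempty (M' ⊞ P ≅ N' ⊞ F) := by
  let Q := (projectiveWeakEquivalences X Z).Q
  have : IsIso (Q.map f) :=
    Localization.inverts _ _ _ (h.projectiveWeakEquivalences_of_approximation hf)
  have : IsIso (Q.map g) :=
    Localization.inverts _ _ _ (h.projectiveWeakEquivalences_of_approximation hg)
  refine Iff.trans ⟨fun ⟨j⟩ => ?_, fun ⟨j⟩ => ?_⟩
    (nonempty_iso_Q_iff isStableIdeal_isProjective (fun _ hP => h.left_of_projective hP)
      h.projectiveWeakEquivalences_biprod_fst E e hf.mem hg.mem)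
  · exact ⟨asIso (Q.map f) ≪≫ E.inverse.preimageIso j ≪≫ (asIso (Q.map g)).symm⟩
  · exact ⟨E.inverse.mapIso ((asIso (Q.map f)).symm ≪≫ j ≪≫ asIso (Q.map g))⟩

theorem nonempty_iso_Q_iff_of_leftApproximation
    (h : IsCompleteHereditaryTriple.{w} X Z Y)
    (E : ModInjectives Y ≌ (injectiveWeakEquivalences Z Y).Localization)
    (e : Quotient.functor _ ⋙ E.functor ≅ Y.ι ⋙ (injectiveWeakEquivalences Z Y).Q)
    {M N M' N' : A} {f : M ⟶ M'} {g : N ⟶ N'} (hf : IsSpecialLeftApproximation.{w} Y f)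
    (hg : IsSpecialLeftApproximation.{w} Y g) :
    Nonempty (E.inverse.obj ((injectiveWeakEquivalences Z Y).Q.obj M) ≅
      E.inverse.obj ((injectiveWeakEquivalences Z Y).Q.obj N)) ↔
      ∃ I J : A, Injective I ∧ Injective J ∧ Nonempty (M' ⊞ I ≅ N' ⊞ J) := by
  let Q := (injectiveWeakEquivalences Z Y).Q
  have : IsIso (Q.map f) :=
    Localization.inverts _ _ _ (h.injectiveWeakEquivalences_of_approximation hf)
  have : IsIso (Q.map g) :=
    Localization.inverts _ _ _ (h.injectiveWeakEquivalences_of_approximation hg)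
  refine Iff.trans ⟨fun ⟨j⟩ => ?_, fun ⟨j⟩ => ?_⟩
    (nonempty_iso_Q_iff isStableIdeal_isInjective (fun _ hI => h.right_of_injective hI)
      h.injectiveWeakEquivalences_biprod_fst E e hf.mem hg.mem)
  · exact ⟨(asIso (Q.map f)).symm ≪≫ E.inverse.preimageIso j ≪≫ asIso (Q.map g)⟩
  · exact ⟨E.inverse.mapIso (asIso (Q.map f) ≪≫ j ≪≫ (asIso (Q.map g)).symm)⟩

end IsCompleteHereditaryTriple

end Cotorsion

/-! ### The main theorem. -/

theorem proposition3p4 {A : Type u} [Category.{v} A] [Abelian A] [HasExt.{w} A]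
    [HasLimits A] [HasColimits A] [EnoughProjectives A] [EnoughInjectives A]
    (X Z Y : ObjectProperty A) (hXZY : Cotorsion.IsCompleteHereditaryTriple.{w} X Z Y) :
    -- the projective side: `X / P ≌ Ho(A)` compatibly with `X ⊆ A`, and equivalence of objects
    (∃ E : Cotorsion.ModProjectives X ≌
        (Cotorsion.projectiveWeakEquivalences X Z).Localization,
      Nonempty (CategoryTheory.Quotient.functor _ ⋙ E.functor ≅
        X.ι ⋙ (Cotorsion.projectiveWeakEquivalences X Z).Q) ∧
      ∀ M N : A,
        (Nonempty (E.inverse.obj ((Cotorsion.projectiveWeakEquivalences X Z).Q.obj M) ≅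
            E.inverse.obj ((Cotorsion.projectiveWeakEquivalences X Z).Q.obj N)) ↔
          ∃ (XM XN : A) (f : XM ⟶ M) (g : XN ⟶ N),
            Cotorsion.IsSpecialRightApproximation.{w} X f ∧
            Cotorsion.IsSpecialRightApproximation.{w} X g ∧
            ∃ P F : A, Projective P ∧ Projective F ∧ Nonempty (XM ⊞ P ≅ XN ⊞ F)) ∧
        (Nonempty (E.inverse.obj ((Cotorsion.projectiveWeakEquivalences X Z).Q.obj M) ≅
            E.inverse.obj ((Cotorsion.projectiveWeakEquivalences X Z).Q.obj N)) ↔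
          ∀ (XM XN : A) (f : XM ⟶ M) (g : XN ⟶ N),
            Cotorsion.IsSpecialRightApproximation.{w} X f →
            Cotorsion.IsSpecialRightApproximation.{w} X g →
            ∃ P F : A, Projective P ∧ Projective F ∧ Nonempty (XM ⊞ P ≅ XN ⊞ F))) ∧
    -- the injective side: `Y / I ≌ Ho(A)` compatibly with `Y ⊆ A`, and equivalence of objects
    (∃ E : Cotorsion.ModInjectives Y ≌
        (Cotorsion.injectiveWeakEquivalences Z Y).Localization,
      Nonempty (CategoryTheory.Quotient.functor _ ⋙ E.functor ≅
        Y.ι ⋙ (Cotorsion.injectiveWeakEquivalences Z Y).Q) ∧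
      ∀ M N : A,
        (Nonempty (E.inverse.obj ((Cotorsion.injectiveWeakEquivalences Z Y).Q.obj M) ≅
            E.inverse.obj ((Cotorsion.injectiveWeakEquivalences Z Y).Q.obj N)) ↔
          ∃ (YM YN : A) (f : M ⟶ YM) (g : N ⟶ YN),
            Cotorsion.IsSpecialLeftApproximation.{w} Y f ∧
            Cotorsion.IsSpecialLeftApproximation.{w} Y g ∧
            ∃ I J : A, Injective I ∧ Injective J ∧ Nonempty (YM ⊞ I ≅ YN ⊞ J)) ∧
        (Nonempty (E.inverse.obj ((Cotorsion.injectiveWeakEquivalences Z Y).Q.obj M) ≅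
            E.inverse.obj ((Cotorsion.injectiveWeakEquivalences Z Y).Q.obj N)) ↔
          ∀ (YM YN : A) (f : M ⟶ YM) (g : N ⟶ YN),
            Cotorsion.IsSpecialLeftApproximation.{w} Y f →
            Cotorsion.IsSpecialLeftApproximation.{w} Y g →
            ∃ I J : A, Injective I ∧ Injective J ∧ Nonempty (YM ⊞ I ≅ YN ⊞ J))) := by
  constructor
  · obtain ⟨E, ⟨e⟩⟩ := Cotorsion.exists_equivalence_of_colocal
      Cotorsion.isStableIdeal_isProjective (fun _ hP => hXZY.left_of_projective hP)
      hXZY.projectiveWeakEquivalences_biprod_fst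
      hXZY.isStablyColocal_of_projectiveWeakEquivalences
      (fun M => (hXZY.exists_specialRightApproximation M).imp fun _ => Exists.imp fun _ hf =>
        ⟨hf.mem, hXZY.projectiveWeakEquivalences_of_approximation hf⟩)
    refine ⟨E, ⟨e⟩, fun M N => ⟨⟨fun h => ?_, ?_⟩, ⟨fun h _ _ _ _ hf hg => ?_, fun h => ?_⟩⟩⟩
    · obtain ⟨M', f, hf⟩ := hXZY.exists_specialRightApproximation M
      obtain ⟨N', g, hg⟩ := hXZY.exists_specialRightApproximation N
      exact ⟨M', N', f, g, hf, hg,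
        (hXZY.nonempty_iso_Q_iff_of_rightApproximation E e hf hg).1 h⟩
    · rintro ⟨M', N', f, g, hf, hg, h⟩
      exact (hXZY.nonempty_iso_Q_iff_of_rightApproximation E e hf hg).2 h
    · exact (hXZY.nonempty_iso_Q_iff_of_rightApproximation E e hf hg).1 h
    -- Completeness supplies approximations to which the universal statement can be applied.
    · obtain ⟨M', f, hf⟩ := hXZY.exists_specialRightApproximation M
      obtain ⟨N', g, hg⟩ := hXZY.exists_specialRightApproximation N
      exact (hXZY.nonempty_iso_Q_iff_of_rightApproximation E e hf hg).2 (h _ _ f g hf hg)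
  · obtain ⟨E, ⟨e⟩⟩ := Cotorsion.exists_equivalence_of_local
      Cotorsion.isStableIdeal_isInjective (fun _ hI => hXZY.right_of_injective hI)
      hXZY.injectiveWeakEquivalences_biprod_fst
      hXZY.isStablyLocal_of_injectiveWeakEquivalences
      (fun M => (hXZY.exists_specialLeftApproximation M).imp fun _ => Exists.imp fun _ hf =>
        ⟨hf.mem, hXZY.injectiveWeakEquivalences_of_approximation hf⟩)
    refine ⟨E, ⟨e⟩, fun M N => ⟨⟨fun h => ?_, ?_⟩, ⟨fun h _ _ _ _ hf hg => ?_, fun h => ?_⟩⟩⟩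
    · obtain ⟨M', f, hf⟩ := hXZY.exists_specialLeftApproximation M
      obtain ⟨N', g, hg⟩ := hXZY.exists_specialLeftApproximation N
      exact ⟨M', N', f, g, hf, hg,
        (hXZY.nonempty_iso_Q_iff_of_leftApproximation E e hf hg).1 h⟩
    · rintro ⟨M', N', f, g, hf, hg, h⟩
      exact (hXZY.nonempty_iso_Q_iff_of_leftApproximation E e hf hg).2 h
    · exact (hXZY.nonempty_iso_Q_iff_of_leftApproximation E e hf hg).1 h
    · obtain ⟨M', f, hf⟩ := hXZY.exists_specialLeftApproximation M
      obtain ⟨N', g, hg⟩ := hXZY.exists_specialLeftApproximation N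
      exact (hXZY.nonempty_iso_Q_iff_of_leftApproximation E e hf hg).2 (h _ _ f g hf hg)
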